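/- Let $\mathcal H = F/[F,[F,F]]$ be the Heisenberg Lie algebra over $\mathbb Z$, where $F$ is the free Lie algebra over $\mathbb Z$ on two generators; $\mathcal H$ is free of rank $3$ as a $\mathbb Z$-module. Put $$\Delta_{\mathcal H}=\mathrm{End}_{\mathbb Z}(\mathcal H)\cap \mathrm{Aut}_{\mathbb Q}(\mathcal H\otimes\mathbb Q),\qquad \Gamma_{\mathcal H}=\mathrm{Aut}_{\mathbb Z}(\mathcal H),$$ and for each prime $p$ $$\Delta_{\mathcal H_p}=\mathrm{End}_{\mathbb Z_p}(\mathcal H\otimes\mathbb Z_p)\cap \mathrm{Aut}_{\mathbb Q_p}(\mathcal H\otimes\mathbb Q_p),\qquad \Gamma_{\mathcal H_p}=\mathrm{Aut}_{\mathbb Z_p}(\mathcal H\otimes\mathbb Z_p)$$ (endomorphisms and automorphisms of Lie algebras). Let $\widehat\Gamma_{\mathcal H}=\prod_p\Gamma_{\mathcal H_p}$, let $\widehat\Delta_{\mathcal H}$ be the set of $(\alpha_p)_p\in\prod_p\Delta_{\mathcal H_p}$ with $\alpha_p\in\Gamma_{\mathcal H_p}$ for almost all $p$, and let $\eta_{\mathcal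 H}:\Delta_{\mathcal H}\to\widehat\Delta_{\mathcal H}$ be the diagonal embedding. Regard $\Delta_{\mathcal H_p}$ as a subset of $\widehat\Delta_{\mathcal H}$ by taking the components at all primes other than $p$ to be the identity. Let $R_{\mathcal H}$ and $\widehat R_{\mathcal H}$ be the Hecke rings of $(\Gamma_{\mathcal H},\Delta_{\mathcal H})$ and $(\widehat\Gamma_{\mathcal H},\widehat\Delta_{\mathcal H})$, that is, additively, the free abelian groups on the double cosets $\Gamma_{\mathcal H}\backslash\Delta_{\mathcal H}/\Gamma_{\mathcal H}$ and $\widehat\Gamma_{\mathcal H}\backslash\widehat\Delta_{\mathcal H}/\widehat\Gamma_{\mathcal H}$. Then: 1. For each prime number $p$ there exists $\widehat\alpha\in\Delta_{\mathcal H_p}$ such that the set $\Gamma_{\mathcal H}\backslash\eta_{\mathcal H}^{-1}(\widehat\Gamma_{\mathcal H}\widehat\alpha\widehat\Gamma_{\mathcal H})/\Gamma_{\mathcal H}$ has more than one element. 2. For every $\widehat\alpha\in\widehat\Delta_{\mathcal H}$ the set $\Gamma_{\mathcal H}\backslash\eta_{\mathcal H}^{-1}(\widehat\Gamma_{\mathcal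 H}\widehat\alpha\widehat\Gamma_{\mathcal H})/\Gamma_{\mathcal H}$ is finite, and the additive map $$\eta_{\mathcal H}^*:\widehat R_{\mathcal H}\to R_{\mathcal H},\qquad \widehat\Gamma_{\mathcal H}\widehat\alpha\widehat\Gamma_{\mathcal H}\mapsto\sum \Gamma_{\mathcal H}\beta\Gamma_{\mathcal H},$$ where $\Gamma_{\mathcal H}\beta\Gamma_{\mathcal H}$ runs through that set, is not surjective. -/

import Mathlib

open scoped TensorProduct

noncomputable section

namespace LieHecke

/-- Lie algebra automorphisms form a group under composition. -/
instance lieAutGroup {R L : Type*} [CommRing R] [LieRing L] [LieAlgebra R L] :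
    Group (L ≃ₗ⁅R⁆ L) where
  mul f g := g.trans f
  one := 1
  inv f := f.symm
  mul_assoc _ _ _ := rfl
  one_mul _ := rfl
  mul_one _ := rfl
  inv_mul_cancel f := LieEquiv.self_trans_symm f

instance factPrime (p : Nat.Primes) : Fact p.1.Prime := ⟨p.2⟩

section Lattices

variable (k R K L : Type*) [CommRing k] [CommRing R] [CommRing K] [Algebra k R] [Algebra k K]
  [Algebra R K] [IsScalarTower k R K] [LieRing L] [LieAlgebra k L]

/-- `Aut_K (L ⊗ K)`, the automorphisms of the `K`-Lie algebra `L ⊗ K`. -/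
abbrev AutExt : Type _ := (K ⊗[k] L) ≃ₗ⁅K⁆ (K ⊗[k] L)

/-- The canonical map `L ⊗ R → L ⊗ K`. -/
def scalarMap : (R ⊗[k] L) →ₗ⁅k⁆ (K ⊗[k] L) :=
  LieAlgebra.ExtendScalars.map (IsScalarTower.toAlgHom k R K) LieHom.id

/-- `End_R (L ⊗ R) ∩ Aut_K (L ⊗ K)`: the automorphisms of `L ⊗ K` which are extensions of
endomorphisms of the `R`-Lie algebra `L ⊗ R`. -/
def integralEnd : Submonoid (AutExt k K L) where
  carrier := {g | ∃ φ : (R ⊗[k] L) →ₗ⁅R⁆ (R ⊗[k] L),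
    ∀ x, g (scalarMap k R K L x) = scalarMap k R K L (φ x)}
  one_mem' := ⟨LieHom.id, fun _ => rfl⟩
  mul_mem' := by
    rintro g h ⟨φ, hφ⟩ ⟨ψ, hψ⟩
    refine ⟨φ.comp ψ, fun x => ?_⟩
    change g (h _) = _
    rw [hψ, hφ]
    rfl

/-- `Aut_R (L ⊗ R)` as a subgroup of `Aut_K (L ⊗ K)`: the automorphisms of `L ⊗ K` which are
extensions of automorphisms of the `R`-Lie algebra `L ⊗ R`. -/
def integralAut : Subgroup (AutExt k K L) where
  carrier := {g | ∃ φ : (R ⊗[k] L) ≃ₗ⁅R⁆ (R ⊗[k] L),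
    ∀ x, g (scalarMap k R K L x) = scalarMap k R K L (φ x)}
  one_mem' := ⟨1, fun _ => rfl⟩
  mul_mem' := by
    rintro g h ⟨φ, hφ⟩ ⟨ψ, hψ⟩
    refine ⟨φ * ψ, fun x => ?_⟩
    change g (h _) = _
    rw [hψ, hφ]
    rfl
  inv_mem' := by
    rintro g ⟨φ, hφ⟩
    refine ⟨φ⁻¹, fun x => ?_⟩
    change g.symm _ = scalarMap k R K L (φ.symm x)
    rw [LieEquiv.symm_apply_eq, hφ, LieEquiv.apply_symm_apply]

end Lattices

section BaseChange

variable (k A B L : Type*) [CommRing k] [CommRing A] [CommRing B] [Algebra k A] [Algebra k B]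
  [Algebra A B] [IsScalarTower k A B] [LieRing L] [LieAlgebra k L]

/-- The `B`-linear extension to `L ⊗ B` of an `A`-linear endomorphism `f` of `L ⊗ A`: the unique
`B`-linear map sending `x ⊗ 1` to the image of `f (x ⊗ 1)`. In terms of a basis of `L` it has the
same matrix as `f`. -/
def extendLinear (f : (A ⊗[k] L) →ₗ[A] (A ⊗[k] L)) : (B ⊗[k] L) →ₗ[B] (B ⊗[k] L) :=
  LinearMap.liftBaseChange B
    ((scalarMap k A B L : (A ⊗[k] L) →ₗ[k] (B ⊗[k] L)) ∘ₗ f.restrictScalars k ∘ₗ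
      TensorProduct.mk k A L 1)

theorem scalarMap_tmul (a : A) (x : L) :
    scalarMap k A B L (a ⊗ₜ x) = algebraMap A B a ⊗ₜ x := rfl

theorem scalarMap_smul (a : A) (x : A ⊗[k] L) :
    scalarMap k A B L (a • x) = algebraMap A B a • scalarMap k A B L x := by
  induction x with
  | zero => simp
  | tmul b y =>
    rw [TensorProduct.smul_tmul', scalarMap_tmul, scalarMap_tmul, TensorProduct.smul_tmul',
      smul_eq_mul, smul_eq_mul, map_mul]
  | add x y hx hy => simp only [smul_add, map_add, hx, hy]

theorem extendLinear_tmul (f : (A ⊗[k] L) →ₗ[A] (A ⊗[k] L)) (b : B) (x : L) :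
    extendLinear k A B L f (b ⊗ₜ x) = b • scalarMap k A B L (f (1 ⊗ₜ x)) := by
  simp [extendLinear]

theorem extendLinear_scalarMap (f : (A ⊗[k] L) →ₗ[A] (A ⊗[k] L)) (x : A ⊗[k] L) :
    extendLinear k A B L f (scalarMap k A B L x) = scalarMap k A B L (f x) := by
  induction x with
  | zero => simp
  | tmul a y =>
    rw [scalarMap_tmul, extendLinear_tmul, ← scalarMap_smul, ← map_smul, TensorProduct.smul_tmul',
      smul_eq_mul, mul_one]
  | add x y hx hy => simp only [map_add, hx, hy]

theorem extendLinear_comp (f g : (A ⊗[k] L) →ₗ[A] (A ⊗[k] L)) (x : B ⊗[k] L) :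
    extendLinear k A B L f (extendLinear k A B L g x) = extendLinear k A B L (f ∘ₗ g) x := by
  induction x with
  | zero => simp
  | tmul b y => simp only [extendLinear_tmul, map_smul, extendLinear_scalarMap, LinearMap.comp_apply]
  | add x y hx hy => simp only [map_add, hx, hy]

theorem extendLinear_id (x : B ⊗[k] L) : extendLinear k A B L LinearMap.id x = x := by
  induction x with
  | zero => simp
  | tmul b y => simp [extendLinear_tmul, scalarMap_tmul, TensorProduct.smul_tmul']
  | add x y hx hy => simp only [map_add, hx, hy]

theorem extendLinear_lie (f : (A ⊗[k] L) →ₗ⁅A⁆ (A ⊗[k] L)) (x y : B ⊗[k] L) :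
    extendLinear k A B L f ⁅x, y⁆ = ⁅extendLinear k A B L f x, extendLinear k A B L f y⁆ := by
  induction x with
  | zero => simp
  | add x x' hx hx' => simp only [add_lie, map_add, hx, hx']
  | tmul b u =>
    induction y with
    | zero => simp
    | add y y' hy hy' => simp only [lie_add, map_add, hy, hy']
    | tmul c v =>
      have h : (1 : A) ⊗ₜ[k] ⁅u, v⁆ = ⁅(1 : A) ⊗ₜ[k] u, (1 : A) ⊗ₜ[k] v⁆ := by
        rw [LieAlgebra.ExtendScalars.bracket_tmul, mul_one]
      rw [LieAlgebra.ExtendScalars.bracket_tmul]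
      simp only [extendLinear_tmul, LieHom.coe_toLinearMap, h, LieHom.map_lie, smul_lie, lie_smul,
        smul_smul, mul_comm b c]

/-- Extension of scalars `Aut_A (L ⊗ A) → Aut_B (L ⊗ B)`. -/
def extendAut : AutExt k A L →* AutExt k B L where
  toFun g :=
    { toFun := extendLinear k A B L (g : (A ⊗[k] L) →ₗ⁅A⁆ (A ⊗[k] L))
      map_add' := map_add _
      map_smul' := map_smul _
      map_lie' := extendLinear_lie k A B L _ _ _
      invFun := extendLinear k A B L (g.symm : (A ⊗[k] L) →ₗ⁅A⁆ (A ⊗[k] L))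
      left_inv := fun x => by
        rw [extendLinear_comp]
        convert extendLinear_id k A B L x using 2
        congr 1
        ext y
        simp
      right_inv := fun x => by
        rw [extendLinear_comp]
        convert extendLinear_id k A B L x using 2
        congr 1
        ext y
        simp }
  map_one' := LieEquiv.ext fun x => extendLinear_id k A B L x
  map_mul' f g := LieEquiv.ext fun x => (extendLinear_comp k A B L _ _ x).symm

end BaseChange

section Hecke

variable (L : Type*) [LieRing L] [LieAlgebra ℤ L]

/-- `Δ_L = End(L) ∩ Aut(L ⊗ ℚ)`. -/
abbrev Δ : Submonoid (AutExt ℤ ℚ L) := integralEnd ℤ ℤ ℚ L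

/-- `Γ_L = Aut(L)`. -/
abbrev Γ : Subgroup (AutExt ℤ ℚ L) := integralAut ℤ ℤ ℚ L

/-- `Δ_{L_p} = End(L ⊗ ℤ_p) ∩ Aut(L ⊗ ℚ_p)`. -/
abbrev Δloc (p : Nat.Primes) : Submonoid (AutExt ℤ ℚ_[p] L) := integralEnd ℤ ℤ_[p] ℚ_[p] L

/-- `Γ_{L_p} = Aut(L ⊗ ℤ_p)`. -/
abbrev Γloc (p : Nat.Primes) : Subgroup (AutExt ℤ ℚ_[p] L) := integralAut ℤ ℤ_[p] ℚ_[p] L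

/-- The full product of the local groups `Aut(L ⊗ ℚ_p)` over all primes `p`. -/
abbrev GProd : Type _ := ∀ p : Nat.Primes, AutExt ℤ ℚ_[p] L

/-- The restricted product `Ĝ_L` of the groups `Aut(L ⊗ ℚ_p)` with respect to the `Γ_{L_p}`. -/
def Ghat : Subgroup (GProd L) where
  carrier := {x | ∀ᶠ p in Filter.cofinite, x p ∈ Γloc L p}
  one_mem' := by
    change ∀ᶠ p in Filter.cofinite, (1 : GProd L) p ∈ Γloc L p
    exact Filter.Eventually.of_forall fun p => (Γloc L p).one_mem
  mul_mem' {x y} hx hy := by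
    change ∀ᶠ p in Filter.cofinite, (x * y) p ∈ Γloc L p
    filter_upwards [hx, hy] with p hxp hyp using (Γloc L p).mul_mem hxp hyp
  inv_mem' {x} hx := by
    change ∀ᶠ p in Filter.cofinite, x⁻¹ p ∈ Γloc L p
    filter_upwards [hx] with p hxp using (Γloc L p).inv_mem hxp

/-- `Δ̂_L = (∏ Δ_{L_p}) ∩ Ĝ_L`. -/
def Δhat : Submonoid (GProd L) :=
  Submonoid.pi Set.univ (Δloc L) ⊓ (Ghat L).toSubmonoid

/-- `Γ̂_L = ∏ Γ_{L_p}`. -/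
def Γhat : Subgroup (GProd L) := Subgroup.pi Set.univ (Γloc L)

/-- The diagonal embedding `η_L` of `Δ_L` into `∏ Aut(L ⊗ ℚ_p)`. -/
def eta : Δ L →* GProd L :=
  (MonoidHom.pi fun p : Nat.Primes => extendAut ℤ ℚ ℚ_[p] L).comp (Δ L).subtype

/-- The inclusion of `Aut(L ⊗ ℚ_p)`, hence of `Δ_{L_p}`, into the product, with trivial components
at the other primes. -/
def ofLocal (p : Nat.Primes) : AutExt ℤ ℚ_[p] L →* GProd L :=
  MonoidHom.mulSingle (fun q : Nat.Primes => AutExt ℤ ℚ_[q] L) p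

/-- The set of double cosets `Γ_L \ η_L⁻¹(Γ̂_L α Γ̂_L) / Γ_L`. -/
def cosetsOver (α : GProd L) : Set (HeckeCoset (Δ L) (Γ L) (Γ L)) :=
  HeckeCoset.mk (Γ L) (Γ L) '' (eta L ⁻¹' DoubleCoset.doubleCoset α (Γhat L) (Γhat L))

/-- `Γ_L \ η_L⁻¹(D) / Γ_L` for a double coset `D` in `Γ̂_L \ Δ̂_L / Γ̂_L`. -/
def fiber (D : HeckeCoset (Δhat L) (Γhat L) (Γhat L)) : Set (HeckeCoset (Δ L) (Γ L) (Γ L)) :=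
  Quotient.lift (fun α : Δhat L => cosetsOver L α)
    (fun a b (h : DoubleCoset.doubleCoset (a : GProd L) (Γhat L) (Γhat L) =
        DoubleCoset.doubleCoset (b : GProd L) (Γhat L) (Γhat L)) => by
      simp only [cosetsOver, h]) D

/-- The additive map `η_L^* : R̂_L → R_L` which sends a double coset `D` to the sum of the double
cosets in `Γ_L \ η_L⁻¹(D) / Γ_L` (a `finsum`, so it is meaningful when these sets are finite). -/
def etaStar : HeckeRing (Δhat L) (Γhat L) ℤ →+ HeckeRing (Δ L) (Γ L) ℤ :=
  (Finsupp.liftAddHom fun D : HeckeCoset (Δhat L) (Γhat L) (Γhat L) =>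
    zmultiplesHom (HeckeRing (Δ L) (Γ L) ℤ)
      (∑ᶠ E ∈ fiber L D, HeckeCosetModule.of (Finsupp.single E 1)) :
    (HeckeCoset (Δhat L) (Γhat L) (Γhat L) →₀ ℤ) →+ HeckeRing (Δ L) (Γ L) ℤ)

end Hecke

/-- The Heisenberg Lie algebra: the quotient of the free Lie algebra `F` over `ℤ` on two
generators by the ideal `[F, [F, F]]`. -/
abbrev Heisenberg : Type :=
  FreeLieAlgebra ℤ (Fin 2) ⧸
    (⁅(⊤ : LieIdeal ℤ (FreeLieAlgebra ℤ (Fin 2))),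
      ⁅(⊤ : LieIdeal ℤ (FreeLieAlgebra ℤ (Fin 2))), (⊤ : LieIdeal ℤ (FreeLieAlgebra ℤ (Fin 2)))⁆⁆ :
      LieIdeal ℤ (FreeLieAlgebra ℤ (Fin 2)))

end LieHecke

end

open scoped TensorProduct

noncomputable section

namespace LieHecke

/-! In the basis formed by the two generators and their bracket, an endomorphism is a pair (A, v): a
2×2 matrix A acts on the abelianization, a row v = (x, y) sends the generators into the centre, and
the centre is scaled by det A. It is an automorphism exactly when det A is a unit. All questions
about double cosets thus become questions about the monoid `HeisEnd` over ℤ, ℤ_p, ℚ and ℚ_p.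

Failure of the local-global principle comes from units: ℤ has only ±1, while 1 + p is a unit of ℤ_p.
Take A = diag(p³, p⁹) and v = (1, p³u). Over ℤ_p the unit u = 1 + p can be moved away by diagonal
automorphisms (`eta_witnessΔ_eq`), and away from p the element is invertible. Over ℤ, equivalence
with the case u = 1 forces u ≡ ±1 mod p³ (`pow_dvd_of_mul_witness`), which fails for u = 1 + p.

Finiteness: an adelic double coset fixes every p-adic norm of det A, hence |det A|. Integral
endomorphisms with the same determinant D that are congruent mod D differ by a left automorphism
(`exists_eq_mul_of_dvd`), so finitely many residues bound the cosets.

Non-surjectivity: an element of the image of `etaStar` has equal coefficients at two double cosets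
lying in one adelic double coset (`etaStar_apply_eq`), so a single global double coset from the
example above is not in the image. -/

/-! ### The coordinate model of the Heisenberg Lie ring. -/

/-- The Heisenberg Lie ring in coordinates: `ℤ³` with `⁅u, v⁆ = (0, 0, u₀v₁ - u₁v₀)`. -/
@[ext]
structure HeisenbergModel : Type where
  c₀ : ℤ
  c₁ : ℤ
  c₂ : ℤ

namespace HeisenbergModel

instance : Zero HeisenbergModel := ⟨⟨0, 0, 0⟩⟩

instance : Add HeisenbergModel := ⟨fun u v => ⟨u.c₀ + v.c₀, u.c₁ + v.c₁, u.c₂ + v.c₂⟩⟩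

instance : Neg HeisenbergModel := ⟨fun u => ⟨-u.c₀, -u.c₁, -u.c₂⟩⟩

theorem zero_def : (0 : HeisenbergModel) = ⟨0, 0, 0⟩ := rfl

theorem add_def (u v : HeisenbergModel) : u + v = ⟨u.c₀ + v.c₀, u.c₁ + v.c₁, u.c₂ + v.c₂⟩ := rfl

theorem neg_def (u : HeisenbergModel) : -u = ⟨-u.c₀, -u.c₁, -u.c₂⟩ := rfl

instance : AddCommGroup HeisenbergModel where
  __ := AddGroup.ofLeftAxioms (G := HeisenbergModel)
    (fun u v w => by simp only [add_def, add_assoc])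
    (fun u => by simp only [add_def, zero_def, zero_add])
    (fun u => by simp only [add_def, zero_def, neg_def, neg_add_cancel])
  add_comm u v := by simp only [add_def, add_comm]

instance : LieRing HeisenbergModel where
  bracket u v := ⟨0, 0, u.c₀ * v.c₁ - u.c₁ * v.c₀⟩
  add_lie u v w := by ext <;> simp only [add_def] <;> ring
  lie_add u v w := by ext <;> simp only [add_def] <;> ring
  lie_self u := by ext <;> simp only [zero_def]; ring
  leibniz_lie u v w := by ext <;> simp only [add_def] <;> ring

theorem lie_def (u v : HeisenbergModel) : ⁅u, v⁆ = ⟨0, 0, u.c₀ * v.c₁ - u.c₁ * v.c₀⟩ := rfl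

theorem lie_lie_eq_zero (u v w : HeisenbergModel) : ⁅u, ⁅v, w⁆⁆ = 0 := by
  simp only [lie_def, zero_def, mul_zero, sub_zero]

/-- The coordinates of the Heisenberg Lie ring as an additive equivalence. -/
def equivFun : HeisenbergModel ≃+ (Fin 3 → ℤ) where
  toFun u := ![u.c₀, u.c₁, u.c₂]
  invFun v := ⟨v 0, v 1, v 2⟩
  left_inv _ := rfl
  right_inv v := by ext i; fin_cases i <;> rfl
  map_add' u v := by ext i; fin_cases i <;> rfl

theorem equivFun_apply (u : HeisenbergModel) : equivFun u = ![u.c₀, u.c₁, u.c₂] := rfl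

theorem equivFun_symm_apply (v : Fin 3 → ℤ) : equivFun.symm v = ⟨v 0, v 1, v 2⟩ := rfl

theorem zsmul_def (n : ℤ) (u : HeisenbergModel) : n • u = ⟨n * u.c₀, n * u.c₁, n * u.c₂⟩ := by
  apply equivFun.injective
  rw [map_zsmul]
  ext i
  fin_cases i <;> simp [equivFun_apply]

end HeisenbergModel

/-! ### The universal property of the free Lie ring. -/

section FreeLie

variable {X L : Type*} [LieRing L]

/-- The universal property of the free Lie ring. -/
def freeLieLift (f : X → L) : FreeLieAlgebra ℤ X →ₗ⁅ℤ⁆ L where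
  toFun := FreeLieAlgebra.lift ℤ f
  map_add' := map_add _
  map_smul' n x := map_zsmul (FreeLieAlgebra.lift ℤ f) n x
  map_lie' := LieHom.map_lie _ _ _

theorem freeLieLift_of (f : X → L) (i : X) : freeLieLift f (FreeLieAlgebra.of ℤ i) = f i :=
  FreeLieAlgebra.lift_of_apply f i

theorem freeLie_hom_ext {f g : FreeLieAlgebra ℤ X →ₗ⁅ℤ⁆ L}
    (h : ∀ i, f (FreeLieAlgebra.of ℤ i) = g (FreeLieAlgebra.of ℤ i)) (x : FreeLieAlgebra ℤ X) :
    f x = g x := by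
  -- A free Lie ring carries two ℤ-Lie algebra structures, the one of any Lie ring and its own; they
  -- agree, but `FreeLieAlgebra.hom_ext` speaks of the second.
  let algHom (f : FreeLieAlgebra ℤ X →ₗ⁅ℤ⁆ L) :
      @LieHom ℤ (FreeLieAlgebra ℤ X) L _ _ (FreeLieAlgebra.instLieAlgebra ℤ X) _ _ :=
    { toFun := f
      map_add' := map_add f
      map_smul' := fun n x => map_zsmul f n x
      map_lie' := LieHom.map_lie f _ _ }
  have key : algHom f = algHom g := FreeLieAlgebra.hom_ext h
  exact congrArg (fun F => F x) key

end FreeLie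

/-! ### F/[F,[F,F]] is free of rank 3. -/

/-- The ideal `[F, [F, F]]` of the free Lie algebra `F` on two generators. -/
abbrev heisenbergIdeal : LieIdeal ℤ (FreeLieAlgebra ℤ (Fin 2)) :=
  ⁅(⊤ : LieIdeal ℤ (FreeLieAlgebra ℤ (Fin 2))),
    ⁅(⊤ : LieIdeal ℤ (FreeLieAlgebra ℤ (Fin 2))), (⊤ : LieIdeal ℤ (FreeLieAlgebra ℤ (Fin 2)))⁆⁆

/-- The quotient map `F → F / [F, [F, F]]`. -/
def Heisenberg.mk : FreeLieAlgebra ℤ (Fin 2) →ₗ⁅ℤ⁆ Heisenberg where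
  toFun := LieSubmodule.Quotient.mk (N := heisenbergIdeal)
  map_add' _ _ := rfl
  map_smul' _ _ := rfl
  map_lie' := rfl

theorem Heisenberg.mk_surjective : Function.Surjective Heisenberg.mk := Quot.mk_surjective

theorem Heisenberg.lie_lie_eq_zero (u v w : Heisenberg) : ⁅u, ⁅v, w⁆⁆ = 0 := by
  obtain ⟨u, rfl⟩ := Heisenberg.mk_surjective u
  obtain ⟨v, rfl⟩ := Heisenberg.mk_surjective v
  obtain ⟨w, rfl⟩ := Heisenberg.mk_surjective w
  rw [← LieHom.map_lie, ← LieHom.map_lie]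
  exact LieSubmodule.Quotient.mk_eq_zero'.2 (LieSubmodule.lie_mem_lie (LieSubmodule.mem_top _)
    (LieSubmodule.lie_mem_lie (LieSubmodule.mem_top _) (LieSubmodule.mem_top _)))

/-- The images in the Heisenberg Lie algebra of the generators of the free Lie algebra. -/
def Heisenberg.gen (i : Fin 2) : Heisenberg := Heisenberg.mk (FreeLieAlgebra.of ℤ i)

/-- The map from the free Lie algebra to the coordinate model of the Heisenberg algebra. -/
def freeToModel : FreeLieAlgebra ℤ (Fin 2) →ₗ⁅ℤ⁆ HeisenbergModel :=
  freeLieLift ![⟨1, 0, 0⟩, ⟨0, 1, 0⟩]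

theorem heisenbergIdeal_le_ker : heisenbergIdeal ≤ freeToModel.ker := by
  refine (LieSubmodule.lie_le_iff _ _ _).2 fun u _ m hm => ?_
  rw [LieHom.mem_ker, LieHom.map_lie]
  rw [← LieSubmodule.mem_toSubmodule, LieSubmodule.lieIdeal_oper_eq_linear_span'] at hm
  induction hm using Submodule.span_induction with
  | mem x hx =>
    obtain ⟨v, -, w, -, rfl⟩ := hx
    rw [LieHom.map_lie, HeisenbergModel.lie_lie_eq_zero]
  | zero => rw [map_zero, lie_zero]
  | add x y _ _ hx hy => rw [map_add, lie_add, hx, hy, add_zero]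
  | smul t x _ hx => rw [map_smul, lie_smul, hx, smul_zero]

/-- The coordinates on the Heisenberg Lie algebra. -/
def toModel : Heisenberg →ₗ[ℤ] HeisenbergModel :=
  Submodule.liftQ _ (freeToModel : FreeLieAlgebra ℤ (Fin 2) →ₗ[ℤ] HeisenbergModel)
    (fun _ hx => heisenbergIdeal_le_ker hx)

theorem toModel_mk (x : FreeLieAlgebra ℤ (Fin 2)) : toModel (Heisenberg.mk x) = freeToModel x :=
  rfl

/-- The map from the coordinate model to the Heisenberg Lie algebra. -/
def ofModel : HeisenbergModel →ₗ⁅ℤ⁆ Heisenberg where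
  toFun u := u.c₀ • Heisenberg.gen 0 + u.c₁ • Heisenberg.gen 1 +
    u.c₂ • ⁅Heisenberg.gen 0, Heisenberg.gen 1⁆
  map_add' u v := by
    simp only [HeisenbergModel.add_def]
    module
  map_smul' t u := by
    simp only [HeisenbergModel.zsmul_def, RingHom.id_apply]
    module
  map_lie' {u v} := by
    have h (a b c : Heisenberg) : ⁅⁅a, b⁆, c⁆ = 0 := by
      rw [← lie_skew, Heisenberg.lie_lie_eq_zero, neg_zero]
    simp only [HeisenbergModel.lie_def, lie_add, add_lie, lie_smul, smul_lie, lie_self, h,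
      Heisenberg.lie_lie_eq_zero]
    rw [← lie_skew (Heisenberg.gen 1) (Heisenberg.gen 0)]
    module

theorem ofModel_apply (u : HeisenbergModel) :
    ofModel u = u.c₀ • Heisenberg.gen 0 + u.c₁ • Heisenberg.gen 1 +
      u.c₂ • ⁅Heisenberg.gen 0, Heisenberg.gen 1⁆ := rfl

theorem freeToModel_of_zero : freeToModel (FreeLieAlgebra.of ℤ 0) = ⟨1, 0, 0⟩ :=
  freeLieLift_of _ _

theorem freeToModel_of_one : freeToModel (FreeLieAlgebra.of ℤ 1) = ⟨0, 1, 0⟩ :=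
  freeLieLift_of _ _

/-- Both sides are Lie homomorphisms from F, so the two generators decide. This gives the
injectivity of the coordinates in `modelEquiv`. -/
theorem ofModel_freeToModel (x : FreeLieAlgebra ℤ (Fin 2)) :
    ofModel (freeToModel x) = Heisenberg.mk x := by
  refine freeLie_hom_ext (f := ofModel.comp freeToModel) (fun i => ?_) x
  rw [LieHom.comp_apply, ofModel_apply]
  fin_cases i
  · simp [Heisenberg.gen, freeToModel_of_zero]
  · simp [Heisenberg.gen, freeToModel_of_one]

/-- The Heisenberg Lie algebra is isomorphic to its coordinate model. -/
def modelEquiv : Heisenberg ≃ₗ[ℤ] HeisenbergModel where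
  __ := toModel
  invFun := ofModel
  left_inv x := by
    obtain ⟨x, rfl⟩ := Heisenberg.mk_surjective x
    exact ofModel_freeToModel x
  right_inv u := by
    change toModel (ofModel u) = u
    rw [ofModel_apply, Heisenberg.gen, Heisenberg.gen, ← LieHom.map_lie, map_add, map_add, map_smul,
      map_smul, map_smul, toModel_mk, toModel_mk, toModel_mk, LieHom.map_lie, freeToModel_of_zero,
      freeToModel_of_one]
    simp [HeisenbergModel.zsmul_def, HeisenbergModel.add_def, HeisenbergModel.lie_def]

/-- The standard basis of the Heisenberg Lie algebra: the two generators and their bracket. -/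
def heisenbergBasis : Module.Basis (Fin 3) ℤ Heisenberg :=
  Module.Basis.ofEquivFun (modelEquiv ≪≫ₗ HeisenbergModel.equivFun.toIntLinearEquiv)

theorem heisenbergBasis_apply (i : Fin 3) : heisenbergBasis i =
    ofModel (HeisenbergModel.equivFun.symm (Pi.single i 1)) := by
  rw [heisenbergBasis, Module.Basis.coe_ofEquivFun]
  rfl

theorem heisenbergBasis_zero : heisenbergBasis 0 = Heisenberg.gen 0 := by
  simp [heisenbergBasis_apply, HeisenbergModel.equivFun_symm_apply, ofModel_apply]

theorem heisenbergBasis_one : heisenbergBasis 1 = Heisenberg.gen 1 := by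
  simp [heisenbergBasis_apply, HeisenbergModel.equivFun_symm_apply, ofModel_apply]

theorem heisenbergBasis_two :
    heisenbergBasis 2 = ⁅heisenbergBasis 0, heisenbergBasis 1⁆ := by
  rw [heisenbergBasis_zero, heisenbergBasis_one]
  simp [heisenbergBasis_apply, HeisenbergModel.equivFun_symm_apply, ofModel_apply]

/-! ### Brackets in coordinates after extension of scalars. -/

/-- A basis of a Lie algebra consisting of two elements and their bracket, which is central. -/
structure HeisBasis (k L : Type*) [CommRing k] [LieRing L] [LieAlgebra k L] where
  /-- The underlying basis. -/
  basis : Module.Basis (Fin 3) k L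
  basis_two : basis 2 = ⁅basis 0, basis 1⁆
  lie_basis_two : ∀ i, ⁅basis i, basis 2⁆ = 0

section Coordinates

variable {k L : Type*} [CommRing k] [LieRing L] [LieAlgebra k L] (B : HeisBasis k L)
  (K : Type*) [CommRing K] [Algebra k K]

/-- The basis of `L ⊗ K` coming from a basis of `L`. -/
def extBasis : Module.Basis (Fin 3) K (K ⊗[k] L) :=
  Algebra.TensorProduct.basis K B.basis

theorem extBasis_apply (i : Fin 3) : extBasis B K i = 1 ⊗ₜ B.basis i :=
  Algebra.TensorProduct.basis_apply _ _

theorem extBasis_two : extBasis B K 2 = ⁅extBasis B K 0, extBasis B K 1⁆ := by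
  rw [extBasis_apply, extBasis_apply, extBasis_apply, LieAlgebra.ExtendScalars.bracket_tmul,
    mul_one, B.basis_two]

theorem lie_extBasis_two (i : Fin 3) : ⁅extBasis B K i, extBasis B K 2⁆ = 0 := by
  rw [extBasis_apply, extBasis_apply, LieAlgebra.ExtendScalars.bracket_tmul, B.lie_basis_two,
    TensorProduct.tmul_zero]

variable {K}

theorem eq_sum_extBasis (u : K ⊗[k] L) :
    u = (extBasis B K).repr u 0 • extBasis B K 0 + (extBasis B K).repr u 1 • extBasis B K 1 +
      (extBasis B K).repr u 2 • extBasis B K 2 := by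
  conv_lhs => rw [← (extBasis B K).sum_repr u, Fin.sum_univ_three]

theorem repr_sum_extBasis (r s t : K) :
    (extBasis B K).repr (r • extBasis B K 0 + s • extBasis B K 1 + t • extBasis B K 2) 0 = r ∧
    (extBasis B K).repr (r • extBasis B K 0 + s • extBasis B K 1 + t • extBasis B K 2) 1 = s ∧
    (extBasis B K).repr (r • extBasis B K 0 + s • extBasis B K 1 + t • extBasis B K 2) 2 = t := by
  simp

theorem lie_sum_extBasis (r s t r' s' t' : K) :
    ⁅r • extBasis B K 0 + s • extBasis B K 1 + t • extBasis B K 2,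
      r' • extBasis B K 0 + s' • extBasis B K 1 + t' • extBasis B K 2⁆ =
        (r * s' - s * r') • extBasis B K 2 := by
  have h (i : Fin 3) : ⁅extBasis B K 2, extBasis B K i⁆ = 0 := by
    rw [← lie_skew, lie_extBasis_two, neg_zero]
  have h10 : ⁅extBasis B K 1, extBasis B K 0⁆ = -extBasis B K 2 := by
    rw [← lie_skew, ← extBasis_two]
  simp only [lie_add, add_lie, lie_smul, smul_lie, lie_self, lie_extBasis_two, h, h10,
    ← extBasis_two]
  module

theorem lie_eq_smul_extBasis (u v : K ⊗[k] L) :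
    ⁅u, v⁆ = ((extBasis B K).repr u 0 * (extBasis B K).repr v 1 -
      (extBasis B K).repr u 1 * (extBasis B K).repr v 0) • extBasis B K 2 := by
  conv_lhs => rw [eq_sum_extBasis B u, eq_sum_extBasis B v, lie_sum_extBasis]

end Coordinates

/-! ### The monoid of endomorphisms in coordinates. -/

/-- The endomorphisms of the Heisenberg Lie algebra over `K` in coordinates: the columns of the
matrix of an endomorphism are `(a, c, x)`, `(b, d, y)` and `(0, 0, ad - bc)`. -/
@[ext]
structure HeisEnd (K : Type*) where
  a : K
  b : K
  c : K
  d : K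
  x : K
  y : K

namespace HeisEnd

variable {R K : Type*} [CommRing R] [CommRing K]

/-- The determinant of the induced endomorphism of the abelianization. -/
def det (m : HeisEnd K) : K := m.a * m.d - m.b * m.c

instance : One (HeisEnd K) := ⟨⟨1, 0, 0, 1, 0, 0⟩⟩

instance : Mul (HeisEnd K) := ⟨fun m n =>
  ⟨m.a * n.a + m.b * n.c, m.a * n.b + m.b * n.d, m.c * n.a + m.d * n.c, m.c * n.b + m.d * n.d,
    m.x * n.a + m.y * n.c + m.det * n.x, m.x * n.b + m.y * n.d + m.det * n.y⟩⟩

theorem one_def : (1 : HeisEnd K) = ⟨1, 0, 0, 1, 0, 0⟩ := rfl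

theorem mul_def (m n : HeisEnd K) : m * n =
    ⟨m.a * n.a + m.b * n.c, m.a * n.b + m.b * n.d, m.c * n.a + m.d * n.c, m.c * n.b + m.d * n.d,
      m.x * n.a + m.y * n.c + m.det * n.x, m.x * n.b + m.y * n.d + m.det * n.y⟩ := rfl

theorem det_one : (1 : HeisEnd K).det = 1 := by simp [det, one_def]

theorem det_mul (m n : HeisEnd K) : (m * n).det = m.det * n.det := by
  simp only [det, mul_def]
  ring

instance : Monoid (HeisEnd K) where
  mul_assoc m n l := by ext <;> simp only [mul_def, det] <;> ring
  one_mul m := by ext <;> simp [mul_def, one_def, det]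
  mul_one m := by ext <;> simp [mul_def, one_def]

/-- The determinant as a monoid homomorphism. -/
def detHom : HeisEnd K →* K where
  toFun := det
  map_one' := det_one
  map_mul' := det_mul

/-- Extension of scalars. -/
def map (f : R →+* K) (m : HeisEnd R) : HeisEnd K := ⟨f m.a, f m.b, f m.c, f m.d, f m.x, f m.y⟩

theorem det_map (f : R →+* K) (m : HeisEnd R) : (m.map f).det = f m.det := by
  simp [map, det]

theorem map_mul (f : R →+* K) (m n : HeisEnd R) : (m * n).map f = m.map f * n.map f := by
  ext <;> simp [map, mul_def, det]

theorem map_injective {f : R →+* K} (hf : Function.Injective f) :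
    Function.Injective (map f) := fun m n h => by
  simp only [map, HeisEnd.mk.injEq, hf.eq_iff] at h
  ext
  exacts [h.1, h.2.1, h.2.2.1, h.2.2.2.1, h.2.2.2.2.1, h.2.2.2.2.2]

/-- The inverse of `m` when `r` is the inverse of the determinant of `m`. -/
def inverse (m : HeisEnd K) (r : K) : HeisEnd K :=
  ⟨r * m.d, -(r * m.b), -(r * m.c), r * m.a,
    -- The row is -r (x, y) A⁻¹, where A⁻¹ is r times the adjugate of A.
    -(r * (m.x * (r * m.d) - m.y * (r * m.c))), -(r * (m.y * (r * m.a) - m.x * (r * m.b)))⟩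

theorem mul_inverse (m : HeisEnd K) (r : K) (h : m.det * r = 1) : m * m.inverse r = 1 := by
  have h' := h
  rw [det] at h'
  ext <;> simp only [mul_def, inverse, one_def]
  · linear_combination h'
  · ring
  · ring
  · linear_combination h'
  · linear_combination (-(m.x * (r * m.d) - m.y * (r * m.c))) * h
  · linear_combination (-(m.y * (r * m.a) - m.x * (r * m.b))) * h

/-- The right inverse has invertible determinant, hence a right inverse of its own; in a monoid this
makes it two-sided. -/
theorem inverse_mul (m : HeisEnd K) (r : K) (h : m.det * r = 1) : m.inverse r * m = 1 := by
  have h1 := mul_inverse m r h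
  have h2 : (m.inverse r).det * m.det = 1 := by
    rw [mul_comm, ← det_mul, h1, det_one]
  have h3 := mul_inverse (m.inverse r) m.det h2
  calc m.inverse r * m = m.inverse r * m * (m.inverse r * (m.inverse r).inverse m.det) := by
        rw [h3, mul_one]
    _ = m.inverse r * (m * m.inverse r) * (m.inverse r).inverse m.det := by
        simp only [mul_assoc]
    _ = 1 := by rw [h1, mul_one, h3]

end HeisEnd

/-! ### Endomorphisms and automorphisms of L ⊗ K as elements of `HeisEnd`. -/

section Endomorphisms

variable {k L : Type*} [CommRing k] [LieRing L] [LieAlgebra k L] (B : HeisBasis k L)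
  {R K : Type*} [CommRing R] [CommRing K] [Algebra k R] [Algebra k K] [Algebra R K]
  [IsScalarTower k R K]

/-- The endomorphism of `L ⊗ K` with given coordinates. -/
def HeisEnd.toLieHom (m : HeisEnd K) : (K ⊗[k] L) →ₗ⁅K⁆ (K ⊗[k] L) where
  toFun u :=
    (m.a * (extBasis B K).repr u 0 + m.b * (extBasis B K).repr u 1) • extBasis B K 0 +
    (m.c * (extBasis B K).repr u 0 + m.d * (extBasis B K).repr u 1) • extBasis B K 1 +
    (m.x * (extBasis B K).repr u 0 + m.y * (extBasis B K).repr u 1 +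
      m.det * (extBasis B K).repr u 2) • extBasis B K 2
  map_add' u v := by
    simp only [map_add, Finsupp.add_apply]
    module
  map_smul' t u := by
    simp only [map_smul, Finsupp.smul_apply, smul_eq_mul, RingHom.id_apply]
    module
  map_lie' {u v} := by
    simp only [lie_sum_extBasis]
    have h : (extBasis B K).repr (extBasis B K 2) 0 = 0 ∧ (extBasis B K).repr (extBasis B K 2) 1 = 0 ∧
        (extBasis B K).repr (extBasis B K 2) 2 = 1 := by
      simp
    simp only [lie_eq_smul_extBasis B u v, map_smul, Finsupp.smul_apply, h, HeisEnd.det, smul_eq_mul]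
    module

theorem HeisEnd.toLieHom_apply (m : HeisEnd K) (u : K ⊗[k] L) : m.toLieHom B u =
    (m.a * (extBasis B K).repr u 0 + m.b * (extBasis B K).repr u 1) • extBasis B K 0 +
    (m.c * (extBasis B K).repr u 0 + m.d * (extBasis B K).repr u 1) • extBasis B K 1 +
    (m.x * (extBasis B K).repr u 0 + m.y * (extBasis B K).repr u 1 +
      m.det * (extBasis B K).repr u 2) • extBasis B K 2 := rfl

/-- The coordinates of an endomorphism of `L ⊗ K`. -/
def coords (f : (K ⊗[k] L) →ₗ⁅K⁆ (K ⊗[k] L)) : HeisEnd K where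
  a := (extBasis B K).repr (f (extBasis B K 0)) 0
  b := (extBasis B K).repr (f (extBasis B K 1)) 0
  c := (extBasis B K).repr (f (extBasis B K 0)) 1
  d := (extBasis B K).repr (f (extBasis B K 1)) 1
  x := (extBasis B K).repr (f (extBasis B K 0)) 2
  y := (extBasis B K).repr (f (extBasis B K 1)) 2

/-- The third basis vector is the bracket of the first two, so its image is forced to be det times
itself; six entries therefore determine f. -/
theorem toLieHom_coords (f : (K ⊗[k] L) →ₗ⁅K⁆ (K ⊗[k] L)) :
    (coords B f).toLieHom B = f := by
  ext u
  have h2 : f (extBasis B K 2) = (coords B f).det • extBasis B K 2 := by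
    rw [extBasis_two, LieHom.map_lie, lie_eq_smul_extBasis, ← extBasis_two, HeisEnd.det]
    simp only [coords]
    congr 1
    ring
  conv_rhs => rw [eq_sum_extBasis B u, map_add, map_add, map_smul, map_smul, map_smul, h2,
    eq_sum_extBasis B (f (extBasis B K 0)), eq_sum_extBasis B (f (extBasis B K 1))]
  rw [HeisEnd.toLieHom_apply]
  simp only [coords]
  module

theorem coords_toLieHom (m : HeisEnd K) : coords B (m.toLieHom B) = m := by
  ext <;> simp [coords, HeisEnd.toLieHom_apply]

theorem coords_id : coords B (LieHom.id : (K ⊗[k] L) →ₗ⁅K⁆ (K ⊗[k] L)) = 1 := by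
  ext <;> simp [coords, HeisEnd.one_def]

theorem coords_injective : Function.Injective
    (coords B : ((K ⊗[k] L) →ₗ⁅K⁆ (K ⊗[k] L)) → HeisEnd K) :=
  Function.LeftInverse.injective (toLieHom_coords B)

theorem HeisEnd.toLieHom_mul (m n : HeisEnd K) (u : K ⊗[k] L) :
    (m * n).toLieHom B u = m.toLieHom B (n.toLieHom B u) := by
  rw [toLieHom_apply B n u, toLieHom_apply, toLieHom_apply]
  simp only [repr_sum_extBasis, HeisEnd.det_mul]
  simp only [mul_def]
  module

theorem coords_comp (f g : (K ⊗[k] L) →ₗ⁅K⁆ (K ⊗[k] L)) :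
    coords B (f.comp g) = coords B f * coords B g := by
  have h : f.comp g = (coords B f * coords B g).toLieHom B := by
    ext u
    rw [HeisEnd.toLieHom_mul, toLieHom_coords, toLieHom_coords, LieHom.comp_apply]
  rw [h, coords_toLieHom]

theorem scalarMap_extBasis (i : Fin 3) :
    scalarMap k R K L (extBasis B R i) = extBasis B K i := by
  rw [extBasis_apply, extBasis_apply, scalarMap_tmul, map_one]

theorem repr_scalarMap (u : R ⊗[k] L) (i : Fin 3) :
    (extBasis B K).repr (scalarMap k R K L u) i = algebraMap R K ((extBasis B R).repr u i) := by
  have h := congrArg (scalarMap k R K L) (eq_sum_extBasis B u)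
  rw [map_add, map_add, scalarMap_smul, scalarMap_smul, scalarMap_smul, scalarMap_extBasis,
    scalarMap_extBasis, scalarMap_extBasis] at h
  rw [h]
  fin_cases i
  exacts [(repr_sum_extBasis (K := K) B _ _ _).1, (repr_sum_extBasis (K := K) B _ _ _).2.1,
    (repr_sum_extBasis (K := K) B _ _ _).2.2]

theorem toLieHom_map_scalarMap (m : HeisEnd R) (u : R ⊗[k] L) :
    (m.map (algebraMap R K)).toLieHom B (scalarMap k R K L u) =
      scalarMap k R K L (m.toLieHom B u) := by
  rw [HeisEnd.toLieHom_apply, HeisEnd.toLieHom_apply]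
  simp only [repr_scalarMap, HeisEnd.det_map, map_add, scalarMap_smul, scalarMap_extBasis, map_mul]
  rfl

theorem coords_eq_map {g : (K ⊗[k] L) →ₗ⁅K⁆ (K ⊗[k] L)}
    {φ : (R ⊗[k] L) →ₗ⁅R⁆ (R ⊗[k] L)}
    (h : ∀ u, g (scalarMap k R K L u) = scalarMap k R K L (φ u)) :
    coords B g = (coords B φ).map (algebraMap R K) := by
  simp only [coords, HeisEnd.map, ← repr_scalarMap, ← h, scalarMap_extBasis]

variable (K) in
/-- The coordinates of an automorphism of `L ⊗ K`. -/
def autCoords : AutExt k K L →* HeisEnd K where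
  toFun g := coords B (g : (K ⊗[k] L) →ₗ⁅K⁆ (K ⊗[k] L))
  map_one' := coords_id B
  map_mul' f g := coords_comp B (f : (K ⊗[k] L) →ₗ⁅K⁆ (K ⊗[k] L)) g

theorem autCoords_injective : Function.Injective (autCoords B K) := fun _ _ h =>
  LieEquiv.ext fun u => LieHom.congr_fun (coords_injective B h) u

theorem isUnit_det_autCoords (g : AutExt k K L) : IsUnit (autCoords B K g).det :=
  (Group.isUnit g).map (HeisEnd.detHom.comp (autCoords B K))

/-- An element of `HeisEnd K` whose determinant is invertible gives an automorphism. -/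
def HeisEnd.toAut (m : HeisEnd K) (h : IsUnit m.det) : AutExt k K L where
  __ := m.toLieHom B
  invFun := (m.inverse ↑h.unit⁻¹).toLieHom B
  left_inv u := by
    change (m.inverse _).toLieHom B (m.toLieHom B u) = u
    rw [← toLieHom_mul, inverse_mul _ _ h.mul_val_inv, ← coords_id B, toLieHom_coords]
    rfl
  right_inv u := by
    change m.toLieHom B ((m.inverse _).toLieHom B u) = u
    rw [← toLieHom_mul, mul_inverse _ _ h.mul_val_inv, ← coords_id B, toLieHom_coords]
    rfl

theorem HeisEnd.toAut_apply (m : HeisEnd K) (h : IsUnit m.det) (u : K ⊗[k] L) :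
    m.toAut B h u = m.toLieHom B u := rfl

theorem autCoords_toAut (m : HeisEnd K) (h : IsUnit m.det) : autCoords B K (m.toAut B h) = m :=
  coords_toLieHom B m

theorem mem_integralEnd_iff {g : AutExt k K L} :
    g ∈ integralEnd k R K L ↔
      ∃ m : HeisEnd R, autCoords B K g = m.map (algebraMap R K) := by
  constructor
  · rintro ⟨φ, hφ⟩
    exact ⟨coords B φ, coords_eq_map B hφ⟩
  · rintro ⟨m, hm⟩
    refine ⟨m.toLieHom B, fun u => ?_⟩
    rw [← toLieHom_map_scalarMap, ← hm]
    exact (LieHom.congr_fun (toLieHom_coords B (g : _ →ₗ⁅K⁆ _)) _).symm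

theorem mem_integralAut_iff {g : AutExt k K L} :
    g ∈ integralAut k R K L ↔
      ∃ m : HeisEnd R, IsUnit m.det ∧ autCoords B K g = m.map (algebraMap R K) := by
  constructor
  · rintro ⟨φ, hφ⟩
    exact ⟨autCoords B R φ, isUnit_det_autCoords B φ, coords_eq_map B hφ⟩
  · rintro ⟨m, h, hm⟩
    refine ⟨m.toAut B h, fun u => ?_⟩
    rw [HeisEnd.toAut_apply, ← toLieHom_map_scalarMap, ← hm]
    exact (LieHom.congr_fun (toLieHom_coords B (g : _ →ₗ⁅K⁆ _)) _).symm

theorem autCoords_extendAut (g : AutExt k R L) :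
    autCoords B K (extendAut k R K L g) = (autCoords B R g).map (algebraMap R K) :=
  coords_eq_map B fun u => extendLinear_scalarMap k R K L _ u

end Endomorphisms

/-! ### Integral endomorphisms congruent modulo their determinant. -/

/-- The standard basis of the Heisenberg Lie algebra over `ℤ`. -/
def heis : HeisBasis ℤ Heisenberg where
  basis := heisenbergBasis
  basis_two := heisenbergBasis_two
  lie_basis_two i := by rw [heisenbergBasis_two, Heisenberg.lie_lie_eq_zero]

namespace HeisEnd

theorem map_map {R S T : Type*} [CommRing R] [CommRing S] [CommRing T] (f : R →+* S) (g : S →+* T)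
    (m : HeisEnd R) : (m.map f).map g = m.map (g.comp f) := rfl

/-- Integral endomorphisms with the same determinant `D` which are congruent modulo `D` differ by
an automorphism. -/
theorem exists_eq_mul_of_dvd {m n : HeisEnd ℤ} (hD : n.det ≠ 0) (h : m.det = n.det)
    (ha : n.det ∣ m.a - n.a) (hb : n.det ∣ m.b - n.b) (hc : n.det ∣ m.c - n.c)
    (hd : n.det ∣ m.d - n.d) (hx : n.det ∣ m.x - n.x) (hy : n.det ∣ m.y - n.y) :
    ∃ γ : HeisEnd ℤ, γ.det = 1 ∧ m = γ * n := by
  obtain ⟨a, ha⟩ := ha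
  obtain ⟨b, hb⟩ := hb
  obtain ⟨c, hc⟩ := hc
  obtain ⟨d, hd⟩ := hd
  obtain ⟨x, hx⟩ := hx
  obtain ⟨y, hy⟩ := hy
  -- With E the quotient (m - n)/D, both blocks of γ come from multiplying those of E by the
  -- adjugate of the 2×2 block of n, the identity being added to the 2×2 block: adjugate times block
  -- is D.
  let γ : HeisEnd ℤ := ⟨1 + a * n.d - b * n.c, b * n.a - a * n.b, c * n.d - d * n.c,
    1 + d * n.a - c * n.b, x * n.d - y * n.c, y * n.a - x * n.b⟩
  have e₁ : m.a = γ.a * n.a + γ.b * n.c := by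
    rw [det] at ha; simp only [γ]; linear_combination ha
  have e₂ : m.b = γ.a * n.b + γ.b * n.d := by
    rw [det] at hb; simp only [γ]; linear_combination hb
  have e₃ : m.c = γ.c * n.a + γ.d * n.c := by
    rw [det] at hc; simp only [γ]; linear_combination hc
  have e₄ : m.d = γ.c * n.b + γ.d * n.d := by
    rw [det] at hd; simp only [γ]; linear_combination hd
  have hγ : γ.det = 1 := by
    refine mul_right_cancel₀ hD ?_
    rw [one_mul]
    refine Eq.trans ?_ h
    simp only [det, e₁, e₂, e₃, e₄]
    ring
  refine ⟨γ, hγ, ?_⟩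
  ext
  · exact e₁
  · exact e₂
  · exact e₃
  · exact e₄
  · simp only [mul_def, hγ]
    rw [det] at hx; simp only [γ]; linear_combination hx
  · simp only [mul_def, hγ]
    rw [det] at hy; simp only [γ]; linear_combination hy

end HeisEnd

/-! ### Double cosets, globally and prime by prime. -/

section Cosets

variable {L : Type*} [LieRing L] [LieAlgebra ℤ L]

theorem heckeCoset_mk_eq_iff {β β' : Δ L} :
    HeckeCoset.mk (Γ L) (Γ L) β = HeckeCoset.mk (Γ L) (Γ L) β' ↔
      ∃ x ∈ Γ L, ∃ y ∈ Γ L, (β' : AutExt ℤ ℚ L) = x * β * y :=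
  Quotient.eq.trans DoubleCoset.rel_iff

theorem mem_doubleCoset_Γhat {α β : GProd L} :
    β ∈ DoubleCoset.doubleCoset α (Γhat L) (Γhat L) ↔
      ∀ p, ∃ x ∈ Γloc L p, ∃ y ∈ Γloc L p, β p = x * α p * y := by
  rw [DoubleCoset.mem_doubleCoset]
  constructor
  · rintro ⟨x, hx, y, hy, rfl⟩ p
    exact ⟨x p, hx p trivial, y p, hy p trivial, rfl⟩
  · intro h
    choose x hx y hy e using h
    exact ⟨x, fun p _ => hx p, y, fun p _ => hy p, funext e⟩

end Cosets

/-! ### Finiteness of the fibres over adelic double cosets. -/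

section Integral

/-- The integral coordinates of an element of `Δ_H`. -/
def intCoords (β : Δ Heisenberg) : HeisEnd ℤ := (mem_integralEnd_iff heis).1 β.2 |>.choose

theorem map_intCoords (β : Δ Heisenberg) :
    autCoords heis ℚ β = (intCoords β).map (algebraMap ℤ ℚ) :=
  (mem_integralEnd_iff heis).1 β.2 |>.choose_spec

theorem det_intCoords_ne_zero (β : Δ Heisenberg) : (intCoords β).det ≠ 0 := fun h => by
  have := (isUnit_det_autCoords heis (β : AutExt ℤ ℚ Heisenberg)).ne_zero
  rw [map_intCoords, HeisEnd.det_map, h, map_zero] at this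
  exact this rfl

theorem isUnit_map_det {m : HeisEnd ℤ} (h : m.det ≠ 0) :
    IsUnit (m.map (algebraMap ℤ ℚ)).det := by
  rw [HeisEnd.det_map, isUnit_iff_ne_zero]
  simpa using h

/-- The element of `Δ_H` with given integral coordinates. -/
def ofIntCoords (m : HeisEnd ℤ) (h : m.det ≠ 0) : Δ Heisenberg :=
  ⟨(m.map (algebraMap ℤ ℚ)).toAut heis (isUnit_map_det h),
    (mem_integralEnd_iff heis).2 ⟨m, autCoords_toAut heis _ _⟩⟩

theorem map_algebraMap_rat_injective :
    Function.Injective (HeisEnd.map (algebraMap ℤ ℚ)) :=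
  HeisEnd.map_injective (algebraMap ℤ ℚ).injective_int

theorem intCoords_ofIntCoords (m : HeisEnd ℤ) (h : m.det ≠ 0) :
    intCoords (ofIntCoords m h) = m :=
  map_algebraMap_rat_injective ((map_intCoords _).symm.trans (autCoords_toAut heis _ _))

theorem autCoords_eta (β : Δ Heisenberg) (p : Nat.Primes) :
    autCoords heis ℚ_[p] (eta Heisenberg β p) = (intCoords β).map (algebraMap ℤ ℚ_[p]) := by
  refine (autCoords_extendAut heis (β : AutExt ℤ ℚ Heisenberg)).trans ?_
  rw [map_intCoords, HeisEnd.map_map]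
  congr 1

theorem map_algebraMap_padic (m : HeisEnd ℤ) (p : Nat.Primes) :
    (m.map (algebraMap ℤ ℤ_[p])).map (algebraMap ℤ_[p] ℚ_[p]) = m.map (algebraMap ℤ ℚ_[p]) := by
  rw [HeisEnd.map_map]
  congr 1

theorem extendAut_mem_Γloc {g : AutExt ℤ ℚ Heisenberg} (hg : g ∈ Γ Heisenberg) (p : Nat.Primes) :
    extendAut ℤ ℚ ℚ_[p] Heisenberg g ∈ Γloc Heisenberg p := by
  obtain ⟨m, hm, e⟩ := (mem_integralAut_iff heis).1 hg
  refine (mem_integralAut_iff heis).2 ⟨m.map (algebraMap ℤ ℤ_[p]), ?_, ?_⟩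
  · rw [HeisEnd.det_map]
    exact hm.map _
  · rw [map_algebraMap_padic, autCoords_extendAut, e, HeisEnd.map_map]
    congr 1

theorem eta_mem_doubleCoset_of_mk_eq {β β' : Δ Heisenberg}
    (h : HeckeCoset.mk (Γ Heisenberg) (Γ Heisenberg) β =
      HeckeCoset.mk (Γ Heisenberg) (Γ Heisenberg) β') :
    eta Heisenberg β' ∈
      DoubleCoset.doubleCoset (eta Heisenberg β) (Γhat Heisenberg) (Γhat Heisenberg) := by
  obtain ⟨x, hx, y, hy, e⟩ := heckeCoset_mk_eq_iff.1 h
  refine mem_doubleCoset_Γhat.2 fun p => ⟨_, extendAut_mem_Γloc hx p, _, extendAut_mem_Γloc hy p, ?_⟩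
  change extendAut ℤ ℚ ℚ_[p] Heisenberg β' = _ * extendAut ℤ ℚ ℚ_[p] Heisenberg β * _
  rw [e, _root_.map_mul, _root_.map_mul]

/-- The preimage of an adelic double coset is stable under Γ on both sides, so membership can be
tested on any representative. -/
theorem mk_mem_cosetsOver {α : GProd Heisenberg} {β : Δ Heisenberg} :
    HeckeCoset.mk (Γ Heisenberg) (Γ Heisenberg) β ∈ cosetsOver Heisenberg α ↔
      eta Heisenberg β ∈ DoubleCoset.doubleCoset α (Γhat Heisenberg) (Γhat Heisenberg) := by
  constructor
  · rintro ⟨β', hβ', e⟩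
    rw [← DoubleCoset.doubleCoset_eq_of_mem hβ']
    exact eta_mem_doubleCoset_of_mk_eq e
  · exact fun h => ⟨β, h, rfl⟩

theorem norm_det_of_mem_Γloc {p : Nat.Primes} {g : AutExt ℤ ℚ_[p] Heisenberg}
    (hg : g ∈ Γloc Heisenberg p) : ‖(autCoords heis ℚ_[p] g).det‖ = 1 := by
  obtain ⟨m, hm, e⟩ := (mem_integralAut_iff heis).1 hg
  rw [e, HeisEnd.det_map]
  exact PadicInt.isUnit_iff.1 hm

/-- The p-adic norm detects divisibility by each power of p, and prime power divisors decide
divisibility. -/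
theorem natAbs_dvd_natAbs_of_norm_eq {D D' : ℤ}
    (h : ∀ p : Nat.Primes, ‖(D : ℚ_[p])‖ = ‖(D' : ℚ_[p])‖) : D.natAbs ∣ D'.natAbs := by
  refine (Nat.dvd_iff_prime_pow_dvd_dvd _ _).2 fun p k hp hk => ?_
  have hp' : Fact p.Prime := ⟨hp⟩
  rw [← Int.natCast_dvd] at hk ⊢
  rw [Nat.cast_pow] at hk ⊢
  rw [← Padic.norm_int_le_pow_iff_dvd] at hk ⊢
  exact (h ⟨p, hp⟩).symm.trans_le hk

/-- The determinant is multiplicative and has norm 1 on local automorphisms, so its norm is an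
invariant of the double coset. -/
theorem norm_det_eq_of_mem_doubleCoset {α : GProd Heisenberg} {β : Δ Heisenberg}
    (h : eta Heisenberg β ∈ DoubleCoset.doubleCoset α (Γhat Heisenberg) (Γhat Heisenberg))
    (p : Nat.Primes) : ‖((intCoords β).det : ℚ_[p])‖ = ‖(autCoords heis ℚ_[p] (α p)).det‖ := by
  obtain ⟨x, hx, y, hy, e⟩ := mem_doubleCoset_Γhat.1 h p
  have e' := congrArg (fun g => ‖(autCoords heis ℚ_[p] g).det‖) e
  simp only [autCoords_eta, HeisEnd.det_map, _root_.map_mul, HeisEnd.det_mul, norm_mul,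
    norm_det_of_mem_Γloc hx, norm_det_of_mem_Γloc hy, one_mul, mul_one] at e'
  simpa using e'

theorem mk_eq_mk_of_eq_mul {β β' : Δ Heisenberg} {γ : HeisEnd ℤ} (hγ : γ.det = 1)
    (h : intCoords β' = γ * intCoords β) :
    HeckeCoset.mk (Γ Heisenberg) (Γ Heisenberg) β =
      HeckeCoset.mk (Γ Heisenberg) (Γ Heisenberg) β' := by
  have hγ0 : γ.det ≠ 0 := by rw [hγ]; exact one_ne_zero
  refine heckeCoset_mk_eq_iff.2 ⟨ofIntCoords γ hγ0, ?_, 1, one_mem _, ?_⟩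
  · exact (mem_integralAut_iff heis).2 ⟨γ, by simp [hγ], autCoords_toAut heis _ _⟩
  · rw [mul_one]
    apply autCoords_injective heis
    rw [map_intCoords, h, HeisEnd.map_mul, _root_.map_mul, map_intCoords, map_intCoords,
      intCoords_ofIntCoords]

/-- There are only finitely many double cosets of elements of `Δ_H` of given determinant. -/
theorem finite_mk_image_det (N : ℕ) :
    (HeckeCoset.mk (Γ Heisenberg) (Γ Heisenberg) ''
      {β | (intCoords β).det.natAbs = N}).Finite := by
  rcases Nat.eq_zero_or_pos N with rfl | hN
  · convert Set.finite_empty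
    rw [Set.image_eq_empty, Set.eq_empty_iff_forall_notMem]
    exact fun β hβ => det_intCoords_ne_zero β (Int.natAbs_eq_zero.1 hβ)
  have : NeZero N := ⟨hN.ne'⟩
  let T : Set (Δ Heisenberg) := {β | (intCoords β).det.natAbs = N}
  -- The sign is recorded because only |det| is fixed, while the congruence criterion needs equal
  -- determinants.
  let residue : T → (ZMod N × ZMod N × ZMod N) × (ZMod N × ZMod N × ZMod N) × SignType := fun β =>
    let m := intCoords β
    ((m.a, m.b, m.c), (m.d, m.x, m.y), SignType.sign m.det)
  let coset : T → HeckeCoset (Δ Heisenberg) (Γ Heisenberg) (Γ Heisenberg) := fun β =>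
    HeckeCoset.mk _ _ (β : Δ Heisenberg)
  have key : Function.FactorsThrough coset residue := by
    rintro ⟨β, hβ⟩ ⟨β', hβ'⟩ h
    simp only [residue, Prod.mk.injEq] at h
    obtain ⟨⟨ha, hb, hc⟩, ⟨hd, hx, hy⟩, hs⟩ := h
    have hD : (intCoords β').det = (intCoords β).det := by
      rw [← Int.sign_mul_natAbs (intCoords β').det, ← Int.sign_mul_natAbs (intCoords β).det,
        hβ.trans hβ'.symm, Int.sign_eq_sign, Int.sign_eq_sign, hs]
    have hdvd {r s : ℤ} (h : (r : ZMod N) = s) : (intCoords β).det ∣ s - r := by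
      rw [← Int.natAbs_dvd, show (intCoords β).det.natAbs = N from hβ]
      exact (ZMod.intCast_eq_intCast_iff_dvd_sub _ _ _).1 h
    obtain ⟨γ, hγ, e⟩ := HeisEnd.exists_eq_mul_of_dvd (det_intCoords_ne_zero β) hD (hdvd ha)
      (hdvd hb) (hdvd hc) (hdvd hd) (hdvd hx) (hdvd hy)
    exact mk_eq_mk_of_eq_mul hγ e
  -- The coset depends only on the residue, so it extends to a function on the finite set of all
  -- residues; the default value at residues that do not occur is harmless.
  refine (Set.finite_range (Function.extend residue coset fun _ => default)).subset ?_
  rintro _ ⟨β, hβ, rfl⟩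
  exact ⟨residue ⟨β, hβ⟩, key.extend_apply _ _⟩

theorem cosetsOver_finite (α : GProd Heisenberg) : (cosetsOver Heisenberg α).Finite := by
  rcases (cosetsOver Heisenberg α).eq_empty_or_nonempty with h | ⟨_, β₀, h₀, rfl⟩
  · rw [h]
    exact Set.finite_empty
  · refine (finite_mk_image_det (intCoords β₀).det.natAbs).subset (Set.image_mono fun β hβ => ?_)
    have e (p : Nat.Primes) :=
      (norm_det_eq_of_mem_doubleCoset hβ p).trans (norm_det_eq_of_mem_doubleCoset h₀ p).symm
    exact Nat.dvd_antisymm (natAbs_dvd_natAbs_of_norm_eq e)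
      (natAbs_dvd_natAbs_of_norm_eq fun p => (e p).symm)

end Integral

/-! ### The image of `etaStar` does not separate locally equivalent cosets. -/

section NotSurjective

theorem finsum_mem_single_apply {s : Set (HeckeCoset (Δ Heisenberg) (Γ Heisenberg) (Γ Heisenberg))}
    (hs : s.Finite) (E : HeckeCoset (Δ Heisenberg) (Γ Heisenberg) (Γ Heisenberg)) :
    (∑ᶠ E' ∈ s, (HeckeCosetModule.of (Finsupp.single E' 1) :
      HeckeRing (Δ Heisenberg) (Γ Heisenberg) ℤ)) E = s.indicator 1 E := by
  classical
  rw [finsum_mem_eq_finite_toFinset_sum _ hs]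
  change (∑ E' ∈ hs.toFinset, (Finsupp.single E' 1 : _ →₀ ℤ)) E = _
  rw [Finsupp.finsetSum_apply, Set.indicator_apply]
  simp [Finsupp.single_apply]

/-- By additivity it suffices to look at one adelic double coset D, whose image is the indicator
function of its fibre; β and β' lie in the same fibres. -/
theorem etaStar_apply_eq {β β' : Δ Heisenberg}
    (h : eta Heisenberg β' ∈
      DoubleCoset.doubleCoset (eta Heisenberg β) (Γhat Heisenberg) (Γhat Heisenberg))
    (z : HeckeRing (Δhat Heisenberg) (Γhat Heisenberg) ℤ) :
    etaStar Heisenberg z (HeckeCoset.mk _ _ β) = etaStar Heisenberg z (HeckeCoset.mk _ _ β') := by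
  have hfiber (D : HeckeCoset (Δhat Heisenberg) (Γhat Heisenberg) (Γhat Heisenberg)) :
      (fiber Heisenberg D).Finite ∧
      (HeckeCoset.mk (Γ Heisenberg) (Γ Heisenberg) β ∈ fiber Heisenberg D ↔
        HeckeCoset.mk (Γ Heisenberg) (Γ Heisenberg) β' ∈ fiber Heisenberg D) := by
    obtain ⟨α, rfl⟩ := Quotient.exists_rep D
    refine ⟨cosetsOver_finite α, ?_⟩
    change _ ∈ cosetsOver Heisenberg α ↔ _ ∈ cosetsOver Heisenberg α
    rw [mk_mem_cosetsOver, mk_mem_cosetsOver]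
    constructor
    · intro h'
      rwa [← DoubleCoset.doubleCoset_eq_of_mem h']
    · intro h'
      rw [← DoubleCoset.doubleCoset_eq_of_mem h', DoubleCoset.doubleCoset_eq_of_mem h]
      exact DoubleCoset.mem_doubleCoset_self _ _ _
  let ev (E : HeckeCoset (Δ Heisenberg) (Γ Heisenberg) (Γ Heisenberg)) :
      HeckeRing (Δ Heisenberg) (Γ Heisenberg) ℤ →+ ℤ := Finsupp.applyAddHom E
  suffices H : (ev (HeckeCoset.mk _ _ β)).comp (etaStar Heisenberg) =
      (ev (HeckeCoset.mk _ _ β')).comp (etaStar Heisenberg) from DFunLike.congr_fun H z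
  refine Finsupp.addHom_ext fun D n => ?_
  have hval (E) : ev E (etaStar Heisenberg (Finsupp.single D n)) =
      n • (fiber Heisenberg D).indicator 1 E := by
    rw [← finsum_mem_single_apply (hfiber D).1]
    change ev E (Finsupp.liftAddHom _ (Finsupp.single D n)) = n • ev E _
    rw [Finsupp.liftAddHom_apply_single, zmultiplesHom_apply, map_zsmul]
  classical
  change ev _ (etaStar Heisenberg (Finsupp.single D n)) =
    ev _ (etaStar Heisenberg (Finsupp.single D n))
  rw [hval, hval, Set.indicator_apply, Set.indicator_apply]
  simp only [(hfiber D).2, Pi.one_apply]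

theorem etaStar_not_surjective {β β' : Δ Heisenberg}
    (h : eta Heisenberg β' ∈
      DoubleCoset.doubleCoset (eta Heisenberg β) (Γhat Heisenberg) (Γhat Heisenberg))
    (hne : HeckeCoset.mk (Γ Heisenberg) (Γ Heisenberg) β ≠
      HeckeCoset.mk (Γ Heisenberg) (Γ Heisenberg) β') :
    ¬ Function.Surjective (etaStar Heisenberg) := by
  classical
  intro hs
  obtain ⟨z, hz⟩ := hs (HeckeCosetModule.of (Finsupp.single (HeckeCoset.mk _ _ β) 1))
  have e := etaStar_apply_eq h z
  rw [hz, HeckeCosetModule.of_apply, HeckeCosetModule.of_apply, Finsupp.single_eq_same,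
    Finsupp.single_apply, if_neg hne] at e
  exact one_ne_zero e

end NotSurjective

/-! ### Elements equivalent over every ℤ_q but not over ℤ. -/

section Witness

/-- A family of integral endomorphisms. For `u = 1` and `u = 1 + p` they are equivalent over the
`p`-adic integers, but not over `ℤ`. -/
def witness (p u : ℤ) : HeisEnd ℤ := ⟨p ^ 3, 0, 0, p ^ 9, 1, p ^ 3 * u⟩

theorem det_witness (p u : ℤ) : (witness p u).det = p ^ 12 := by
  simp only [witness, HeisEnd.det]
  ring

/-- If `witness p 1` and `witness p u` lie in the same double coset, then `u ≡ ±1` modulo `p ^ 3`. -/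
theorem pow_dvd_of_mul_witness {p u : ℤ} (hp : p ≠ 0) {m n : HeisEnd ℤ} (hm : IsUnit m.det)
    (hn : IsUnit n.det) (h : m * witness p 1 = witness p u * n) :
    p ^ 3 ∣ u - 1 ∨ p ^ 3 ∣ u + 1 := by
  have hP : p ^ 3 ≠ 0 := pow_ne_zero _ hp
  have hb := congrArg HeisEnd.b h
  have hx := congrArg HeisEnd.x h
  have hy := congrArg HeisEnd.y h
  simp only [HeisEnd.mul_def, det_witness] at hb hx hy
  simp only [witness] at hb hx hy
  -- The exponent 9 makes n.b divisible by p⁶, so it still vanishes mod p³ after the factor p³ is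
  -- cancelled from the y-entry. The x- and y-entries then give n.a ≡ det m and u·n.d ≡ det m mod
  -- p³.
  have hb' : n.b = p ^ 6 * m.b := mul_left_cancel₀ hP (by linear_combination -hb)
  have hx' : n.a = m.det + p ^ 3 * (m.x - u * n.c - p ^ 9 * n.x) := by linear_combination -hx
  have hy' : u * n.d = m.det + p ^ 3 * (m.y * p ^ 3 - m.b - p ^ 6 * n.y) :=
    mul_left_cancel₀ hP (by rw [hb'] at hy; linear_combination -hy)
  have hm2 : m.det * m.det = 1 := by
    rcases Int.isUnit_iff.1 hm with e | e <;> rw [e] <;> rfl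
  -- Multiplying the two congruences, with n.b ≡ 0, gives u·det n ≡ (det m)² = 1.
  have key : p ^ 3 ∣ u * n.det - 1 := by
    have : u * n.det = n.a * (u * n.d) - u * n.b * n.c := by rw [HeisEnd.det]; ring
    rw [this, hx', hy', hb']
    refine ⟨m.det * (m.y * p ^ 3 - m.b - p ^ 6 * n.y) + (m.x - u * n.c - p ^ 9 * n.x) *
      (m.det + p ^ 3 * (m.y * p ^ 3 - m.b - p ^ 6 * n.y)) - u * p ^ 3 * m.b * n.c, ?_⟩
    linear_combination hm2
  rcases Int.isUnit_iff.1 hn with e | e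
  · left
    rwa [e, mul_one] at key
  · right
    rwa [e, ← dvd_neg, show -(u * -1 - 1) = u + 1 by ring] at key

/-- Both p and p + 2 are positive and smaller than p³. A square would not do: for p = 2 it divides p
+ 2 = 4. -/
theorem not_pow_dvd {p : ℕ} (hp : 2 ≤ p) :
    ¬ ((p : ℤ) ^ 3 ∣ (1 + p) - 1 ∨ (p : ℤ) ^ 3 ∣ (1 + p) + 1) := by
  have hp' : (2 : ℤ) ≤ p := by exact_mod_cast hp
  have h4 : 4 * (p : ℤ) ≤ p ^ 3 := by nlinarith [mul_le_mul hp' hp' (by norm_num) (by linarith)]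
  rintro (h | h)
  · have := Int.le_of_dvd (by linarith) h
    linarith
  · have := Int.le_of_dvd (by linarith) h
    linarith

theorem witness_det_ne_zero (p : Nat.Primes) (u : ℤ) : (witness p u).det ≠ 0 := by
  rw [det_witness]
  exact pow_ne_zero _ (by exact_mod_cast p.2.ne_zero)

/-- The element of `Δ_H` given by `witness`. -/
def witnessΔ (p : Nat.Primes) (u : ℤ) : Δ Heisenberg :=
  ofIntCoords (witness p u) (witness_det_ne_zero p u)

theorem mk_witnessΔ_ne (p : Nat.Primes) :
    HeckeCoset.mk (Γ Heisenberg) (Γ Heisenberg) (witnessΔ p 1) ≠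
      HeckeCoset.mk (Γ Heisenberg) (Γ Heisenberg) (witnessΔ p (1 + p)) := fun h => by
  obtain ⟨x, hx, y, hy, e⟩ := heckeCoset_mk_eq_iff.1 h
  obtain ⟨m, hm, em⟩ := (mem_integralAut_iff heis).1 hx
  -- Moving y to the other side leaves an identity between integral endomorphisms, which descends
  -- from ℚ to ℤ.
  obtain ⟨n, hn, en⟩ := (mem_integralAut_iff heis).1 ((Γ Heisenberg).inv_mem hy)
  have e' := congrArg (autCoords heis ℚ) (mul_inv_eq_iff_eq_mul.2 e)
  rw [_root_.map_mul, _root_.map_mul, em, en, map_intCoords, map_intCoords, witnessΔ, witnessΔ,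
    intCoords_ofIntCoords, intCoords_ofIntCoords, ← HeisEnd.map_mul, ← HeisEnd.map_mul] at e'
  exact not_pow_dvd p.2.two_le (pow_dvd_of_mul_witness (by exact_mod_cast p.2.ne_zero) hm hn
    (map_algebraMap_rat_injective e').symm)

theorem isUnit_algebraMap_padicInt {p : Nat.Primes} {n : ℤ} (h : IsCoprime n (p : ℤ)) :
    IsUnit (algebraMap ℤ ℤ_[p] n) := by
  rw [PadicInt.isUnit_iff, eq_intCast]
  exact PadicInt.norm_intCast_eq_one_iff.2 h

theorem eta_mem_Γloc_of_ne {p q : Nat.Primes} (h : q ≠ p) (u : ℤ) :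
    eta Heisenberg (witnessΔ p u) q ∈ Γloc Heisenberg q := by
  refine (mem_integralAut_iff heis).2 ⟨(witness p u).map (algebraMap ℤ ℤ_[q]), ?_, ?_⟩
  · rw [HeisEnd.det_map, det_witness, _root_.map_pow]
    exact IsUnit.pow _ (isUnit_algebraMap_padicInt
      (Nat.isCoprime_iff_coprime.2 ((Nat.coprime_primes p.2 q.2).2 fun e => h (Subtype.ext e.symm))))
  · rw [map_algebraMap_padic, autCoords_eta, witnessΔ, intCoords_ofIntCoords]

/-- Left multiplication by diag(u, 1) scales both the first row of A and the row v by u = 1 + p;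
right multiplication by diag(u⁻¹, 1) restores the first column. Only the y-entry keeps the factor u.
-/
theorem eta_witnessΔ_eq (p : Nat.Primes) :
    ∃ x ∈ Γloc Heisenberg p, ∃ y ∈ Γloc Heisenberg p,
      eta Heisenberg (witnessΔ p (1 + p)) p = x * eta Heisenberg (witnessΔ p 1) p * y := by
  set u : ℤ_[p] := algebraMap ℤ ℤ_[p] (1 + p) with hu
  obtain ⟨r, hr⟩ := (isUnit_algebraMap_padicInt (p := p) (n := 1 + p)
    ⟨1, -1, by ring⟩).exists_right_inv
  rw [← hu] at hr
  have hX : IsUnit (⟨u, 0, 0, 1, 0, 0⟩ : HeisEnd ℤ_[p]).det :=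
    IsUnit.of_mul_eq_one r (by simp only [HeisEnd.det]; linear_combination hr)
  have hY : IsUnit (⟨r, 0, 0, 1, 0, 0⟩ : HeisEnd ℤ_[p]).det :=
    IsUnit.of_mul_eq_one u (by simp only [HeisEnd.det]; linear_combination hr)
  have key : (witness p (1 + p)).map (algebraMap ℤ ℤ_[p]) =
      ⟨u, 0, 0, 1, 0, 0⟩ * (witness p 1).map (algebraMap ℤ ℤ_[p]) * ⟨r, 0, 0, 1, 0, 0⟩ := by
    ext <;> simp only [HeisEnd.mul_def, HeisEnd.map, HeisEnd.det, witness, map_mul, map_pow,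
      map_one, map_zero, ← hu]
    · linear_combination (-(algebraMap ℤ ℤ_[p] p) ^ 3) * hr
    · ring
    · ring
    · ring
    · linear_combination -hr
    · ring
  have hX' := hX.map (algebraMap ℤ_[p] ℚ_[p])
  have hY' := hY.map (algebraMap ℤ_[p] ℚ_[p])
  rw [← HeisEnd.det_map] at hX' hY'
  refine ⟨HeisEnd.toAut heis _ hX', (mem_integralAut_iff heis).2 ⟨_, hX, autCoords_toAut heis _ _⟩,
    HeisEnd.toAut heis _ hY', (mem_integralAut_iff heis).2 ⟨_, hY, autCoords_toAut heis _ _⟩, ?_⟩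
  apply autCoords_injective heis
  rw [_root_.map_mul, _root_.map_mul, autCoords_toAut, autCoords_toAut, autCoords_eta,
    autCoords_eta, witnessΔ, witnessΔ, intCoords_ofIntCoords, intCoords_ofIntCoords,
    ← map_algebraMap_padic, ← map_algebraMap_padic, key, HeisEnd.map_mul, HeisEnd.map_mul]

/-- The two elements given by `witness` map to the same local double coset at `p` and are locally
invertible at all other primes. -/
theorem eta_witnessΔ_mem (p : Nat.Primes) {u : ℤ} (hu : u = 1 ∨ u = 1 + p) :
    eta Heisenberg (witnessΔ p u) ∈ DoubleCoset.doubleCoset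
      (ofLocal Heisenberg p (eta Heisenberg (witnessΔ p 1) p))
      (Γhat Heisenberg) (Γhat Heisenberg) := by
  refine mem_doubleCoset_Γhat.2 fun q => ?_
  by_cases hq : q = p
  · subst hq
    have e : ofLocal Heisenberg q (eta Heisenberg (witnessΔ q 1) q) q =
        eta Heisenberg (witnessΔ q 1) q := Pi.mulSingle_eq_same _ _
    rw [e]
    rcases hu with rfl | rfl
    · exact ⟨1, one_mem _, 1, one_mem _, by rw [one_mul, mul_one]⟩
    · exact eta_witnessΔ_eq q
  -- Away from p the component of `ofLocal` is the identity, so the local image itself serves as the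
  -- left factor.
  · refine ⟨_, eta_mem_Γloc_of_ne hq u, 1, one_mem _, ?_⟩
    have e : ofLocal Heisenberg p (eta Heisenberg (witnessΔ p 1) p) q = 1 :=
      Pi.mulSingle_eq_of_ne hq _
    rw [e, mul_one, mul_one]

end Witness

end LieHecke

end

theorem mainTheorem2 :
    (∀ p : Nat.Primes, ∃ α ∈ LieHecke.Δloc LieHecke.Heisenberg p,
      1 < (LieHecke.cosetsOver LieHecke.Heisenberg
        (LieHecke.ofLocal LieHecke.Heisenberg p α)).encard) ∧
    (∀ α ∈ LieHecke.Δhat LieHecke.Heisenberg,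
      (LieHecke.cosetsOver LieHecke.Heisenberg α).Finite) ∧
    ¬ Function.Surjective (LieHecke.etaStar LieHecke.Heisenberg) := by
  refine ⟨fun p => ?_, fun α _ => LieHecke.cosetsOver_finite α, ?_⟩
  · refine ⟨LieHecke.eta _ (LieHecke.witnessΔ p 1) p, ?_, ?_⟩
    · refine (LieHecke.mem_integralEnd_iff LieHecke.heis).2
        ⟨(LieHecke.witness p 1).map (algebraMap ℤ ℤ_[p]), ?_⟩
      rw [LieHecke.map_algebraMap_padic, LieHecke.autCoords_eta, LieHecke.witnessΔ,
        LieHecke.intCoords_ofIntCoords]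
    · exact Set.one_lt_encard_iff.2 ⟨_, _,
        LieHecke.mk_mem_cosetsOver.2 (LieHecke.eta_witnessΔ_mem p (Or.inl rfl)),
        LieHecke.mk_mem_cosetsOver.2 (LieHecke.eta_witnessΔ_mem p (Or.inr rfl)),
        LieHecke.mk_witnessΔ_ne p⟩
  -- Any prime would do.
  · let p : Nat.Primes := ⟨2, Nat.prime_two⟩
    refine LieHecke.etaStar_not_surjective ?_ (LieHecke.mk_witnessΔ_ne p)
    rw [DoubleCoset.doubleCoset_eq_of_mem (LieHecke.eta_witnessΔ_mem p (Or.inl rfl))]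
    exact LieHecke.eta_witnessΔ_mem p (Or.inr rfl)
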